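/- Let $f:\mathbb R\to\mathbb R$ be twice differentiable with $f(u)>0$, $f'(u)\ge 0$ and $f''(u)>0$ for all $u\in\mathbb R$, and $\lim_{u\to\infty} f(u)/u=\infty$. Let $\alpha>0$ and $\lambda>0$ be fixed. Put $F(u)=\int_0^u f(t)\,dt$, let $F^{-1}:[0,\infty)\to[0,\infty)$ be the inverse of $F|_{[0,\infty)}$, and for $C\ge 0$ let $\mathcal K_C=\{(v,u): v^2/2\le C,\ u=F^{-1}(C-v^2/2)\}$. Let $v_1(C)\ge 0$ be the unique number for which $(v_1,\tfrac{\sqrt\lambda}{\alpha}v_1)\in\mathcal K_C$, that is, $F\big(\tfrac{\sqrt\lambda}{\alpha}v_1\big)+\tfrac{v_1^2}{2}=C$, and set $$L(C)=\frac{2}{\sqrt\lambda}\int_0^{v_1(C)}\frac{dv}{f\big(F^{-1}(C-\frac{v^2}{2})\big)},\qquad C\ge 0 .$$ Then: 1. For all $C>0$ and $\ell>0$, the problem $u''+\lambda f(u)=0$ in $(0,\ell)$, $u'(0)=\alpha u(0)$, $u'(\ell)=-\alpha u(\ell)$ has a solution whose trajectory $\big(\tfrac{u'(x)}{\sqrt\lambda},u(x)\big)$,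 $0\le x\le \ell$, lies on $\mathcal K_C$ if and only if $\ell=L(C)$. 2. $L$ is bounded on $[0,\infty)$. 3. $L(0)=0=\lim_{C\to 0^+}L(C)$, and $L(C)\to 0$ as $C\to\infty$. 4. $L$ is differentiable on $(0,\infty)$ and has exactly one critical point there, i.e. there is exactly one $C>0$ with $L'(C)=0$. -/

import Mathlib

open Set Filter Topology

noncomputable section

namespace RobinTimeMap

/-- The primitive `F(u) = ∫₀ᵘ f(t) dt`. -/
def primitive (f : ℝ → ℝ) (u : ℝ) : ℝ := ∫ t in (0 : ℝ)..u, f t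

/-- The inverse `F⁻¹ : [0, ∞) → [0, ∞)` of the primitive. -/
def primitiveInv (f : ℝ → ℝ) (s : ℝ) : ℝ := Function.invFunOn (primitive f) (Ici 0) s

/-- The phase plane curve `K_C` of energy level `C`, as a set of points `(v, u)`:
`u = F⁻¹(C - v² / 2)`, where `v² / 2 ≤ C`. -/
def phaseCurve (f : ℝ → ℝ) (C : ℝ) : Set (ℝ × ℝ) :=
  {p | p.1 ^ 2 / 2 ≤ C ∧ p.2 = primitiveInv f (C - p.1 ^ 2 / 2)}

/-- The line `𝓛⁺` of points `(v, u)` with `u = γ v`, `γ = √lam / α`. -/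
def robinLine (lam α : ℝ) : Set (ℝ × ℝ) := {p | p.2 = Real.sqrt lam / α * p.1}

/-- The abscissa `v₁(C) ≥ 0` of the intersection point `P⁺ = (v₁, γ v₁)` of `𝓛⁺` with `K_C`. It
exists and is unique for `C ≥ 0`, see `existsUnique_vOne`. -/
def vOne (f : ℝ → ℝ) (lam α C : ℝ) : ℝ :=
  Classical.epsilon fun v : ℝ =>
    0 ≤ v ∧ (v, Real.sqrt lam / α * v) ∈ phaseCurve f C ∩ robinLine lam α

/-- The length `L(C) = 2 ∫₀^{v₁(C)} dv / (√lam f(F⁻¹(C - v² / 2)))`. -/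
def length (f : ℝ → ℝ) (lam α C : ℝ) : ℝ :=
  2 * ∫ v in (0 : ℝ)..vOne f lam α C,
    1 / (Real.sqrt lam * f (primitiveInv f (C - v ^ 2 / 2)))

/-- `u`, with derivative `u'`, is a classical solution (of class `C¹` on `[0, ℓ]`, twice
differentiable in `(0, ℓ)`) of `u'' + lam f(u) = 0` in `(0, ℓ)` with the Robin conditions
`u'(0) = α u(0)` and `u'(ℓ) = - α u(ℓ)`. -/
structure IsRobinSolution (f : ℝ → ℝ) (lam α ℓ : ℝ) (u u' : ℝ → ℝ) : Prop where
  hasDeriv : ∀ x ∈ Icc 0 ℓ, HasDerivWithinAt u (u' x) (Icc 0 ℓ) x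
  continuousOn : ContinuousOn u' (Icc 0 ℓ)
  equation : ∀ x ∈ Ioo 0 ℓ, HasDerivAt u' (-(lam * f (u x))) x
  left : u' 0 = α * u 0
  right : u' ℓ = -(α * u ℓ)

theorem primitive_strictMono {f : ℝ → ℝ} (hc : Continuous f) (hpos : ∀ u, 0 < f u) :
    StrictMono (primitive f) := by
  refine strictMono_of_deriv_pos fun x => ?_
  have h : deriv (primitive f) x = f x := (hc.integral_hasStrictDerivAt 0 x).hasDerivAt.deriv
  rw [h]
  exact hpos x

theorem primitive_continuous {f : ℝ → ℝ} (hc : Continuous f) : Continuous (primitive f) :=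
  continuous_iff_continuousAt.2 fun x =>
    (hc.integral_hasStrictDerivAt 0 x).hasDerivAt.continuousAt

theorem primitive_zero (f : ℝ → ℝ) : primitive f 0 = 0 := by simp [primitive]

theorem le_primitive {f : ℝ → ℝ} (hc : Continuous f) (hm : Monotone f) {u : ℝ} (hu : 0 ≤ u) :
    u * f 0 ≤ primitive f u := by
  have h : ∫ _t in (0 : ℝ)..u, f 0 ≤ ∫ t in (0 : ℝ)..u, f t :=
    intervalIntegral.integral_mono_on hu (by simp) (hc.intervalIntegrable _ _)
      fun x hx => hm hx.1
  simpa [primitive] using h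

theorem exists_primitive_eq {f : ℝ → ℝ} (hc : Continuous f) (hm : Monotone f)
    (hpos : ∀ u, 0 < f u) {s : ℝ} (hs : 0 ≤ s) : ∃ u ∈ Ici (0 : ℝ), primitive f u = s := by
  have hs' : 0 ≤ s / f 0 := div_nonneg hs (hpos 0).le
  have h1 : s ≤ primitive f (s / f 0) := by
    have := le_primitive hc hm hs'
    rwa [div_mul_cancel₀ _ (hpos 0).ne'] at this
  obtain ⟨u, hu, h⟩ := intermediate_value_Icc hs' (primitive_continuous hc).continuousOn
    (show s ∈ Icc _ _ from ⟨by rw [primitive_zero]; exact hs, h1⟩)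
  exact ⟨u, hu.1, h⟩

theorem primitiveInv_eq_iff {f : ℝ → ℝ} (hc : Continuous f) (hm : Monotone f)
    (hpos : ∀ u, 0 < f u) {s u : ℝ} (hs : 0 ≤ s) : u = primitiveInv f s ↔ primitive f u = s := by
  have h : primitive f (primitiveInv f s) = s :=
    Function.invFunOn_eq (exists_primitive_eq hc hm hpos hs)
  constructor
  · rintro rfl
    exact h
  · intro hu
    exact (primitive_strictMono hc hpos).injective (hu.trans h.symm)

theorem existsUnique_vOne {f : ℝ → ℝ} (hc : Continuous f) (hm : Monotone f)
    (hpos : ∀ u, 0 < f u) {lam α C : ℝ} (hlam : 0 < lam) (hα : 0 < α) (hC : 0 ≤ C) :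
    ∃! v : ℝ, 0 ≤ v ∧ (v, Real.sqrt lam / α * v) ∈ phaseCurve f C ∩ robinLine lam α := by
  have hγ : 0 < Real.sqrt lam / α := div_pos (Real.sqrt_pos.2 hlam) hα
  set γ := Real.sqrt lam / α with hγd
  have hF := primitive_strictMono hc hpos
  have hnn : ∀ v : ℝ, 0 ≤ v → 0 ≤ primitive f (γ * v) := fun v hv => by
    rw [← primitive_zero f]
    exact hF.monotone (mul_nonneg hγ.le hv)
  have key : ∀ v : ℝ, 0 ≤ v → ((v, γ * v) ∈ phaseCurve f C ∩ robinLine lam α ↔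
      primitive f (γ * v) + v ^ 2 / 2 = C) := by
    intro v hv
    constructor
    · rintro ⟨⟨h1, h2⟩, -⟩
      simp only at h1 h2
      have := (primitiveInv_eq_iff hc hm hpos (sub_nonneg.2 h1)).1 h2
      linarith
    · intro h
      have h1 : v ^ 2 / 2 ≤ C := by linarith [hnn v hv]
      exact ⟨⟨h1, (primitiveInv_eq_iff hc hm hpos (sub_nonneg.2 h1)).2 (by simp only; linarith)⟩,
        rfl⟩
  have hcont : Continuous fun v : ℝ => primitive f (γ * v) + v ^ 2 / 2 :=
    ((primitive_continuous hc).comp (continuous_const.mul continuous_id)).add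
      ((continuous_id.pow 2).div_const 2)
  have hup : C ≤ primitive f (γ * (C + 1)) + (C + 1) ^ 2 / 2 := by
    nlinarith [hnn (C + 1) (by linarith)]
  obtain ⟨v, hv, hvC⟩ := intermediate_value_Icc (show (0 : ℝ) ≤ C + 1 by linarith)
    hcont.continuousOn (show C ∈ Icc _ _ from ⟨by simpa [primitive_zero] using hC, hup⟩)
  refine ⟨v, ⟨hv.1, (key v hv.1).2 hvC⟩, ?_⟩
  rintro w ⟨hw, hwC⟩
  have hwC' := (key w hw).1 hwC
  simp only at hvC
  rcases lt_trichotomy w v with h | h | h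
  · have := hF (mul_lt_mul_of_pos_left h hγ)
    nlinarith [hv.1]
  · exact h
  · have := hF (mul_lt_mul_of_pos_left h hγ)
    nlinarith [hv.1]

end RobinTimeMap

end

/-! In the time `√lam * x`, the point `(v, u)` with `v = -u' / √lam` obeys `u' = -v`, `v' = f(u)`
and conserves `F(u) + v² / 2`. Since `v' > 0`, time is a function of `v` along a trajectory.
`travelTime` integrates `dv / f(u)` from the apex `v = 0`, and a Robin solution runs from `-v₁` to
`v₁`, so `√lam * L(C) = 2 T(C)` with `T(C) = travelTime f C (v₁(C))`.

Monotonicity of `f` bounds the integrand by its value at `v₁`, so `T ≤ v₁ / f(γ v₁)` with `γ = √lam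
/ α`. With superlinearity this gives boundedness and the limit at infinity; with `v₁² ≤ 2 C` it
gives the limit at `0`. An interior maximum of the positive function `L` is then a critical point.

Uniqueness holds because every critical point `C₀` is a strict global maximum
(`travelTime_lt_of_deriv_length_eq_zero`). Criticality says that the energy derivative of the
trajectory satisfies the same linear condition `u = γ v` at time `T(C₀)`. If `T(C) ≥ T(C₀)`, the
Wronskian of that derivative with the difference of the two trajectories starts at `0`, does not
increase, by convexity of `f`, and ends nonnegative. Hence it vanishes, which strict convexity
forbids at the apex. -/

noncomputable section

namespace RobinTimeMap

/-! ### The inverse of the primitive. -/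

section Inverse

variable {f : ℝ → ℝ}

theorem primitive_hasStrictDerivAt (hc : Continuous f) (u : ℝ) :
    HasStrictDerivAt (primitive f) (f u) u :=
  hc.integral_hasStrictDerivAt 0 u

theorem primitive_nonneg (hc : Continuous f) (hpos : ∀ u, 0 < f u) {u : ℝ} (hu : 0 ≤ u) :
    0 ≤ primitive f u := by
  rw [← primitive_zero f]
  exact (primitive_strictMono hc hpos).monotone hu

theorem primitiveInv_nonneg (hc : Continuous f) (hm : Monotone f) (hpos : ∀ u, 0 < f u) {s : ℝ}
    (hs : 0 ≤ s) : 0 ≤ primitiveInv f s :=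
  Function.invFunOn_mem (exists_primitive_eq hc hm hpos hs)

theorem primitive_primitiveInv (hc : Continuous f) (hm : Monotone f) (hpos : ∀ u, 0 < f u) {s : ℝ}
    (hs : 0 ≤ s) : primitive f (primitiveInv f s) = s :=
  (primitiveInv_eq_iff hc hm hpos hs).1 rfl

theorem primitiveInv_primitive (hc : Continuous f) (hm : Monotone f) (hpos : ∀ u, 0 < f u) {u : ℝ}
    (hu : 0 ≤ u) : primitiveInv f (primitive f u) = u :=
  ((primitiveInv_eq_iff hc hm hpos (primitive_nonneg hc hpos hu)).2 rfl).symm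

/-- The inverse of the primitive, extended to the real line by its value at `0`. -/
def posInv (f : ℝ → ℝ) (s : ℝ) : ℝ := primitiveInv f (max s 0)

theorem posInv_of_nonneg {s : ℝ} (hs : 0 ≤ s) : posInv f s = primitiveInv f s := by
  rw [posInv, max_eq_left hs]

theorem posInv_nonneg (hc : Continuous f) (hm : Monotone f) (hpos : ∀ u, 0 < f u) (s : ℝ) :
    0 ≤ posInv f s :=
  primitiveInv_nonneg hc hm hpos (le_max_right _ _)

theorem primitive_posInv (hc : Continuous f) (hm : Monotone f) (hpos : ∀ u, 0 < f u) (s : ℝ) :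
    primitive f (posInv f s) = max s 0 :=
  primitive_primitiveInv hc hm hpos (le_max_right _ _)

theorem posInv_monotone (hc : Continuous f) (hm : Monotone f) (hpos : ∀ u, 0 < f u) :
    Monotone (posInv f) := by
  intro a b hab
  rw [← (primitive_strictMono hc hpos).le_iff_le, primitive_posInv hc hm hpos,
    primitive_posInv hc hm hpos]
  exact max_le_max_right _ hab

/-- A monotone map onto `[0, ∞)` has no jumps. -/
theorem posInv_continuous (hc : Continuous f) (hm : Monotone f) (hpos : ∀ u, 0 < f u) :
    Continuous (posInv f) := by
  have hsurj : ∀ y, 0 ≤ y → ∃ s, posInv f s = y := fun y hy =>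
    ⟨primitive f y, by
      rw [posInv_of_nonneg (primitive_nonneg hc hpos hy), primitiveInv_primitive hc hm hpos hy]⟩
  have h : Monotone fun s => (⟨posInv f s, posInv_nonneg hc hm hpos s⟩ : Ici (0 : ℝ)) :=
    fun a b hab => posInv_monotone hc hm hpos hab
  have hcont := h.continuous_of_surjective fun y => by
    obtain ⟨s, hs⟩ := hsurj y y.2
    exact ⟨s, Subtype.ext hs⟩
  exact continuous_subtype_val.comp hcont

theorem posInv_hasDerivAt (hc : Continuous f) (hm : Monotone f) (hpos : ∀ u, 0 < f u) {s : ℝ}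
    (hs : 0 < s) : HasDerivAt (posInv f) (1 / f (posInv f s)) s := by
  have hg : primitive f (posInv f s) = s := by
    rw [primitive_posInv hc hm hpos, max_eq_left hs.le]
  refine HasDerivAt.congr_deriv (HasDerivAt.of_local_left_inverse (f := primitive f)
    (posInv_continuous hc hm hpos).continuousAt
    (primitive_hasStrictDerivAt hc _).hasDerivAt (hpos _).ne' ?_) (one_div _).symm
  filter_upwards [lt_mem_nhds hs] with y hy
  rw [primitive_posInv hc hm hpos, max_eq_left hy.le]

end Inverse

/-! ### The intersection point as a function of the energy, and conversely. -/

section Energy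

variable {f : ℝ → ℝ} {lam α : ℝ}

/-- The energy of the point `(v, γ v)`. -/
def energy (f : ℝ → ℝ) (γ v : ℝ) : ℝ := primitive f (γ * v) + v ^ 2 / 2

theorem vOne_spec (hc : Continuous f) (hm : Monotone f) (hpos : ∀ u, 0 < f u) (hlam : 0 < lam)
    (hα : 0 < α) {C : ℝ} (hC : 0 ≤ C) :
    0 ≤ vOne f lam α C ∧ energy f (√lam / α) (vOne f lam α C) = C := by
  obtain ⟨h0, ⟨h1, h2⟩, -⟩ :=
    Classical.epsilon_spec (existsUnique_vOne hc hm hpos hlam hα hC).exists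
  refine ⟨h0, ?_⟩
  have := (primitiveInv_eq_iff hc hm hpos (sub_nonneg.2 h1)).1 h2
  simp only at this
  simp only [energy, vOne]
  linarith

theorem energy_strictMonoOn (hc : Continuous f) (hpos : ∀ u, 0 < f u) {γ : ℝ} (hγ : 0 < γ) :
    StrictMonoOn (energy f γ) (Ici 0) := by
  intro a ha b _ hab
  have h1 := primitive_strictMono hc hpos (mul_lt_mul_of_pos_left hab hγ)
  have ha' : 0 ≤ a := ha
  simp only [energy]
  nlinarith

theorem energy_nonneg (hc : Continuous f) (hpos : ∀ u, 0 < f u) {γ : ℝ} (hγ : 0 < γ) {v : ℝ}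
    (hv : 0 ≤ v) : 0 ≤ energy f γ v :=
  add_nonneg (primitive_nonneg hc hpos (mul_nonneg hγ.le hv)) (by positivity)

theorem vOne_energy (hc : Continuous f) (hm : Monotone f) (hpos : ∀ u, 0 < f u) (hlam : 0 < lam)
    (hα : 0 < α) {v : ℝ} (hv : 0 ≤ v) : vOne f lam α (energy f (√lam / α) v) = v := by
  have hγ : 0 < √lam / α := div_pos (Real.sqrt_pos.2 hlam) hα
  obtain ⟨h0, h1⟩ := vOne_spec hc hm hpos hlam hα (energy_nonneg hc hpos hγ hv)
  exact (energy_strictMonoOn hc hpos hγ).injOn h0 hv h1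

theorem vOne_pos (hc : Continuous f) (hm : Monotone f) (hpos : ∀ u, 0 < f u) (hlam : 0 < lam)
    (hα : 0 < α) {C : ℝ} (hC : 0 < C) : 0 < vOne f lam α C := by
  obtain ⟨h0, h1⟩ := vOne_spec hc hm hpos hlam hα hC.le
  refine lt_of_le_of_ne h0 fun h => ?_
  rw [← h] at h1
  simp [energy, primitive_zero] at h1
  exact hC.ne h1

theorem energy_hasStrictDerivAt (hc : Continuous f) (γ v : ℝ) :
    HasStrictDerivAt (energy f γ) (γ * f (γ * v) + v) v := by
  have h1 : HasStrictDerivAt (fun v : ℝ => γ * v) γ v := by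
    simpa using (hasStrictDerivAt_id v).const_mul γ
  have h2 := (primitive_hasStrictDerivAt hc (γ * v)).comp v h1
  have h3 : HasStrictDerivAt (fun v : ℝ => v ^ 2 / 2) v v := by
    simpa using ((hasStrictDerivAt_id v).pow 2).div_const 2
  exact (h2.add h3).congr_deriv (by ring)

/-- On `[0, ∞)` `vOne` inverts `energy`, whose strict derivative is positive, so the inverse
function theorem applies. -/
theorem vOne_hasDerivAt (hc : Continuous f) (hm : Monotone f) (hpos : ∀ u, 0 < f u)
    (hlam : 0 < lam) (hα : 0 < α) {v : ℝ} (hv : 0 < v) :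
    HasDerivAt (vOne f lam α) (√lam / α * f (√lam / α * v) + v)⁻¹ (energy f (√lam / α) v) := by
  have hγ : 0 < √lam / α := div_pos (Real.sqrt_pos.2 hlam) hα
  refine ((energy_hasStrictDerivAt hc (√lam / α) v).to_local_left_inverse ?_ ?_).hasDerivAt
  · have := mul_pos hγ (hpos (√lam / α * v))
    positivity
  · filter_upwards [lt_mem_nhds hv] with y hy
    exact vOne_energy hc hm hpos hlam hα hy.le

theorem vOne_sq_le (hc : Continuous f) (hm : Monotone f) (hpos : ∀ u, 0 < f u) (hlam : 0 < lam)
    (hα : 0 < α) {C : ℝ} (hC : 0 ≤ C) : vOne f lam α C ^ 2 / 2 ≤ C := by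
  have hγ : 0 < √lam / α := div_pos (Real.sqrt_pos.2 hlam) hα
  obtain ⟨h0, h1⟩ := vOne_spec hc hm hpos hlam hα hC
  have := primitive_nonneg hc hpos (mul_nonneg hγ.le h0)
  simp only [energy] at h1
  linarith

theorem vOne_sq_lt (hc : Continuous f) (hm : Monotone f) (hpos : ∀ u, 0 < f u) (hlam : 0 < lam)
    (hα : 0 < α) {C : ℝ} (hC : 0 < C) : vOne f lam α C ^ 2 / 2 < C := by
  have hγ : 0 < √lam / α := div_pos (Real.sqrt_pos.2 hlam) hα
  obtain ⟨h0, h1⟩ := vOne_spec hc hm hpos hlam hα hC.le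
  have := primitive_strictMono hc hpos (mul_pos hγ (vOne_pos hc hm hpos hlam hα hC))
  rw [primitive_zero] at this
  simp only [energy] at h1
  linarith

theorem posInv_vOne (hc : Continuous f) (hm : Monotone f) (hpos : ∀ u, 0 < f u) (hlam : 0 < lam)
    (hα : 0 < α) {C : ℝ} (hC : 0 ≤ C) :
    posInv f (C - vOne f lam α C ^ 2 / 2) = √lam / α * vOne f lam α C := by
  have hγ : 0 < √lam / α := div_pos (Real.sqrt_pos.2 hlam) hα
  obtain ⟨h0, h1⟩ := vOne_spec hc hm hpos hlam hα hC
  have h2 := sub_nonneg.2 (vOne_sq_le hc hm hpos hlam hα hC)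
  rw [posInv_of_nonneg h2]
  refine ((primitiveInv_eq_iff hc hm hpos h2).2 ?_).symm
  simp only [energy] at h1
  linarith

end Energy

/-! ### Trajectories as inverses of the travel time. -/

section TravelTime

variable {f : ℝ → ℝ}

/-- The time the trajectory of `u' = -v`, `v' = f(u)` on the curve of energy `C` takes from its
apex, where `v = 0`, to the point of abscissa `v`. -/
def travelTime (f : ℝ → ℝ) (C v : ℝ) : ℝ := ∫ s in (0 : ℝ)..v, 1 / f (posInv f (C - s ^ 2 / 2))

theorem length_eq_travelTime (hc : Continuous f) (hm : Monotone f) (hpos : ∀ u, 0 < f u)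
    {lam α : ℝ} (hlam : 0 < lam) (hα : 0 < α) {C : ℝ} (hC : 0 ≤ C) :
    length f lam α C = 2 / √lam * travelTime f C (vOne f lam α C) := by
  obtain ⟨h0, h1⟩ := vOne_spec hc hm hpos hlam hα hC
  have h2 := vOne_sq_le hc hm hpos hlam hα hC
  have : ∫ v in (0 : ℝ)..vOne f lam α C, 1 / (√lam * f (primitiveInv f (C - v ^ 2 / 2))) =
      ∫ v in (0 : ℝ)..vOne f lam α C, (√lam)⁻¹ * (1 / f (posInv f (C - v ^ 2 / 2))) := by
    refine intervalIntegral.integral_congr fun v hv => ?_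
    rw [uIcc_of_le h0] at hv
    have : v ^ 2 ≤ vOne f lam α C ^ 2 := pow_le_pow_left₀ hv.1 hv.2 2
    rw [posInv_of_nonneg (by linarith), one_div, mul_inv, one_div]
  rw [length, this, intervalIntegral.integral_const_mul, travelTime]
  ring

theorem continuous_inv_comp_posInv (hc : Continuous f) (hm : Monotone f) (hpos : ∀ u, 0 < f u) :
    Continuous fun s => 1 / f (posInv f s) :=
  continuous_const.div (hc.comp (posInv_continuous hc hm hpos)) fun _ => (hpos _).ne'

theorem travelTime_zero (C : ℝ) : travelTime f C 0 = 0 := by simp [travelTime]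

theorem travelTime_neg (C v : ℝ) : travelTime f C (-v) = -travelTime f C v := by
  have := intervalIntegral.integral_comp_neg (a := 0) (b := v)
    fun s => 1 / f (posInv f (C - s ^ 2 / 2))
  simp only [even_two, Even.neg_pow, neg_zero] at this
  rw [travelTime, travelTime, this, intervalIntegral.integral_symm]

theorem travelTime_hasStrictDerivAt (hc : Continuous f) (hm : Monotone f) (hpos : ∀ u, 0 < f u)
    (C v : ℝ) : HasStrictDerivAt (travelTime f C) (1 / f (posInv f (C - v ^ 2 / 2))) v := by
  have h : Continuous fun s : ℝ => 1 / f (posInv f (C - s ^ 2 / 2)) :=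
    (continuous_inv_comp_posInv hc hm hpos).comp (by fun_prop)
  exact h.integral_hasStrictDerivAt 0 v

theorem travelTime_strictMono (hc : Continuous f) (hm : Monotone f) (hpos : ∀ u, 0 < f u)
    (C : ℝ) : StrictMono (travelTime f C) :=
  strictMono_of_deriv_pos fun v => by
    rw [(travelTime_hasStrictDerivAt hc hm hpos C v).hasDerivAt.deriv]
    exact one_div_pos.2 (hpos _)

theorem travelTime_continuous (hc : Continuous f) (hm : Monotone f) (hpos : ∀ u, 0 < f u)
    (C : ℝ) : Continuous (travelTime f C) :=
  continuous_iff_continuousAt.2 fun v =>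
    (travelTime_hasStrictDerivAt hc hm hpos C v).hasDerivAt.continuousAt

theorem div_le_travelTime (hc : Continuous f) (hm : Monotone f) (hpos : ∀ u, 0 < f u) (C : ℝ)
    {v : ℝ} (hv : 0 ≤ v) : v / f (posInv f C) ≤ travelTime f C v := by
  have h : Continuous fun s : ℝ => 1 / f (posInv f (C - s ^ 2 / 2)) :=
    (continuous_inv_comp_posInv hc hm hpos).comp (by fun_prop)
  have := intervalIntegral.integral_mono_on (μ := MeasureTheory.volume) hv
    (f := fun _ => 1 / f (posInv f C)) (by simp) (h.intervalIntegrable 0 v) fun s _ =>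
      one_div_le_one_div_of_le (hpos _) (hm (posInv_monotone hc hm hpos
        (show C - s ^ 2 / 2 ≤ C by nlinarith [sq_nonneg s])))
  rw [intervalIntegral.integral_const, smul_eq_mul, sub_zero, mul_one_div] at this
  exact this

/-- The clamp in `posInv` keeps the integrand at least `1 / f (posInv f C)` even where `s² / 2 > C`,
which no trajectory reaches. So the travel time is a bijection of the line and `velocity` is defined
for all times. -/
theorem travelTime_surjective (hc : Continuous f) (hm : Monotone f) (hpos : ∀ u, 0 < f u)
    (C : ℝ) : Function.Surjective (travelTime f C) := by
  have htop : Tendsto (travelTime f C) atTop atTop := by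
    refine tendsto_atTop_mono' atTop ?_ (tendsto_id.atTop_div_const (hpos (posInv f C)))
    filter_upwards [eventually_ge_atTop 0] with v hv
    exact div_le_travelTime hc hm hpos C hv
  have hbot : Tendsto (travelTime f C) atBot atBot := by
    have := tendsto_neg_atTop_atBot.comp (htop.comp tendsto_neg_atBot_atTop)
    refine this.congr fun v => ?_
    simp [travelTime_neg]
  exact (travelTime_continuous hc hm hpos C).surjective htop hbot

/-- The abscissa, at time `t`, of the trajectory of energy `C` that is at its apex at time `0`. -/
def velocity (f : ℝ → ℝ) (C t : ℝ) : ℝ := Function.invFun (travelTime f C) t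

theorem travelTime_velocity (hc : Continuous f) (hm : Monotone f) (hpos : ∀ u, 0 < f u)
    (C t : ℝ) : travelTime f C (velocity f C t) = t :=
  Function.rightInverse_invFun (travelTime_surjective hc hm hpos C) t

theorem velocity_travelTime (hc : Continuous f) (hm : Monotone f) (hpos : ∀ u, 0 < f u)
    (C v : ℝ) : velocity f C (travelTime f C v) = v :=
  Function.leftInverse_invFun (travelTime_strictMono hc hm hpos C).injective v

theorem velocity_zero (hc : Continuous f) (hm : Monotone f) (hpos : ∀ u, 0 < f u) (C : ℝ) :
    velocity f C 0 = 0 := by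
  simpa [travelTime_zero] using velocity_travelTime hc hm hpos C 0

theorem velocity_monotone (hc : Continuous f) (hm : Monotone f) (hpos : ∀ u, 0 < f u) (C : ℝ) :
    Monotone (velocity f C) := fun a b hab => by
  rwa [← (travelTime_strictMono hc hm hpos C).le_iff_le, travelTime_velocity hc hm hpos,
    travelTime_velocity hc hm hpos]

theorem velocity_hasDerivAt (hc : Continuous f) (hm : Monotone f) (hpos : ∀ u, 0 < f u)
    (C t : ℝ) : HasDerivAt (velocity f C) (f (posInv f (C - velocity f C t ^ 2 / 2))) t := by
  have h := (travelTime_hasStrictDerivAt hc hm hpos C (velocity f C t)).to_local_left_inverse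
    (g := velocity f C) (one_div_pos.2 (hpos _)).ne'
    (Eventually.of_forall (velocity_travelTime hc hm hpos C))
  rw [travelTime_velocity hc hm hpos] at h
  simpa using h.hasDerivAt

/-- The ordinate, at time `t`, of the trajectory of energy `C` that is at its apex at time `0`. -/
def position (f : ℝ → ℝ) (C t : ℝ) : ℝ := posInv f (C - velocity f C t ^ 2 / 2)

/-- The hypothesis `h` keeps the argument of `posInv` positive, away from the clamp; only there is
`position` a genuine trajectory. -/
theorem position_hasDerivAt (hc : Continuous f) (hm : Monotone f) (hpos : ∀ u, 0 < f u)
    {C t : ℝ} (h : velocity f C t ^ 2 / 2 < C) :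
    HasDerivAt (position f C) (-velocity f C t) t := by
  have h1 : HasDerivAt (fun t => C - velocity f C t ^ 2 / 2)
      (-(velocity f C t * f (position f C t))) t := by
    refine ((((velocity_hasDerivAt hc hm hpos C t).pow 2).div_const 2).const_sub C).congr_deriv ?_
    simp only [position]
    push_cast
    ring
  refine ((posInv_hasDerivAt hc hm hpos (sub_pos.2 h)).comp t h1).congr_deriv ?_
  have := (hpos (position f C t)).ne'
  rw [mul_neg, mul_comm (velocity f C t), one_div]
  exact congrArg Neg.neg (inv_mul_cancel_left₀ this _)

end TravelTime

/-! ### Robin solutions on a phase curve. -/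

section Solutions

variable {f : ℝ → ℝ} {lam α : ℝ}

theorem abs_velocity_le (hc : Continuous f) (hm : Monotone f) (hpos : ∀ u, 0 < f u) {C v t : ℝ}
    (ht : |t| ≤ travelTime f C v) : |velocity f C t| ≤ v := by
  have hmono := travelTime_strictMono hc hm hpos C
  obtain ⟨h1, h2⟩ := abs_le.1 ht
  refine abs_le.2 ⟨?_, ?_⟩
  · rwa [← hmono.le_iff_le, travelTime_neg, travelTime_velocity hc hm hpos]
  · rwa [← hmono.le_iff_le, travelTime_velocity hc hm hpos]

theorem velocity_sq_lt (hc : Continuous f) (hm : Monotone f) (hpos : ∀ u, 0 < f u)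
    (hlam : 0 < lam) (hα : 0 < α) {C t : ℝ} (hC : 0 < C)
    (ht : |t| ≤ travelTime f C (vOne f lam α C)) : velocity f C t ^ 2 / 2 < C := by
  have h1 := vOne_sq_lt hc hm hpos hlam hα hC
  have h2 := pow_le_pow_left₀ (abs_nonneg _) (abs_velocity_le hc hm hpos ht) 2
  rw [sq_abs] at h2
  linarith

theorem exists_robinSolution (hc : Continuous f) (hm : Monotone f) (hpos : ∀ u, 0 < f u)
    (hlam : 0 < lam) (hα : 0 < α) {C : ℝ} (hC : 0 < C) :
    ∃ u u' : ℝ → ℝ, IsRobinSolution f lam α (length f lam α C) u u' ∧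
      ∀ x ∈ Icc 0 (length f lam α C), (u' x / √lam, u x) ∈ phaseCurve f C := by
  have hs : 0 < √lam := Real.sqrt_pos.2 hlam
  set v₁ := vOne f lam α C with hv₁
  set T := travelTime f C v₁ with hT
  have hL : √lam * length f lam α C = 2 * T := by
    rw [length_eq_travelTime hc hm hpos hlam hα hC.le]
    field_simp
    rfl
  have hend : position f C T = √lam / α * v₁ := by
    rw [position, hT, velocity_travelTime hc hm hpos]
    exact posInv_vOne hc hm hpos hlam hα hC.le
  have hVT : velocity f C T = v₁ := velocity_travelTime hc hm hpos C v₁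
  have hVnT : velocity f C (-T) = -v₁ := by
    rw [hT, ← travelTime_neg, velocity_travelTime hc hm hpos]
  have hend' : position f C (-T) = √lam / α * v₁ := by
    rw [← hend, position, position, hVnT, hVT, neg_sq]
  have hV : ∀ x ∈ Icc 0 (length f lam α C), velocity f C (√lam * x - T) ^ 2 / 2 < C := by
    intro x hx
    have h1 : |√lam * x - T| ≤ T := by
      have := mul_le_mul_of_nonneg_left hx.2 hs.le
      have := mul_nonneg hs.le hx.1
      exact abs_le.2 ⟨by linarith, by linarith⟩
    exact velocity_sq_lt hc hm hpos hlam hα hC h1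
  have haff : ∀ x, HasDerivAt (fun x => √lam * x - T) √lam x := fun x => by
    simpa using ((hasDerivAt_id x).const_mul √lam).sub_const T
  have hvel : ∀ x, HasDerivAt (fun x => -(√lam * velocity f C (√lam * x - T)))
      (-(lam * f (position f C (√lam * x - T)))) x := fun x => by
    refine (((velocity_hasDerivAt hc hm hpos C _).comp x (haff x)).const_mul √lam).neg.congr_deriv
      ?_
    rw [position, mul_left_comm, Real.mul_self_sqrt hlam.le, mul_comm]
  -- The solution is symmetric about the midpoint of the interval, so the apex is placed there: `x =
  -- 0` and `x = ℓ` become the times `-T` and `T`.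
  refine ⟨fun x => position f C (√lam * x - T), fun x => -(√lam * velocity f C (√lam * x - T)),
    ⟨fun x hx => ?_, fun x _ => (hvel x).continuousAt.continuousWithinAt, fun x _ => hvel x,
      ?_, ?_⟩, fun x hx => ⟨?_, ?_⟩⟩
  · refine HasDerivAt.hasDerivWithinAt ?_
    refine ((position_hasDerivAt hc hm hpos (hV x hx)).comp x (haff x)).congr_deriv ?_
    ring
  · simp only [mul_zero, zero_sub, hend', hVnT]
    field_simp
  · have h : √lam * length f lam α C - T = T := by linarith
    simp only [h, hend, hVT]
    field_simp
  · have := hV x hx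
    simp only [neg_div, neg_sq, mul_div_cancel_left₀ _ hs.ne']
    exact this.le
  · simp only [neg_div, neg_sq, mul_div_cancel_left₀ _ hs.ne']
    rw [position, posInv_of_nonneg (sub_nonneg.2 (hV x hx).le)]

/-- A point of the curve has `u ≥ 0`, hence `v ≥ 0` on the Robin line, and the energy is injective
there. This fixes both endpoints of a solution, the right one after the reflection `v ↦ -v`. -/
theorem eq_vOne_of_mem_phaseCurve (hc : Continuous f) (hm : Monotone f) (hpos : ∀ u, 0 < f u)
    (hlam : 0 < lam) (hα : 0 < α) {C v u : ℝ} (hu : (v, u) ∈ phaseCurve f C)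
    (h : √lam * v = α * u) : v = vOne f lam α C := by
  have hs : 0 < √lam := Real.sqrt_pos.2 hlam
  obtain ⟨h1, h2⟩ := hu
  simp only at h1 h2
  have hu0 : 0 ≤ u := h2 ▸ primitiveInv_nonneg hc hm hpos (sub_nonneg.2 h1)
  have hv0 : 0 ≤ v := nonneg_of_mul_nonneg_right (h ▸ mul_nonneg hα.le hu0) hs
  have huv : u = √lam / α * v := by
    field_simp
    linarith
  have hF := (primitiveInv_eq_iff hc hm hpos (sub_nonneg.2 h1)).1 h2
  have hE : energy f (√lam / α) v = C := by
    rw [energy, ← huv]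
    linarith
  rw [← hE, vOne_energy hc hm hpos hlam hα hv0]

theorem IsRobinSolution.eq_length (hc : Continuous f) (hm : Monotone f) (hpos : ∀ u, 0 < f u)
    (hlam : 0 < lam) (hα : 0 < α) {C : ℝ} (hC : 0 < C) {ℓ : ℝ} (hℓ : 0 < ℓ) {u u' : ℝ → ℝ}
    (h : IsRobinSolution f lam α ℓ u u')
    (hK : ∀ x ∈ Icc 0 ℓ, (u' x / √lam, u x) ∈ phaseCurve f C) : ℓ = length f lam α C := by
  have hs : 0 < √lam := Real.sqrt_pos.2 hlam
  have h0 : u' 0 / √lam = vOne f lam α C :=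
    eq_vOne_of_mem_phaseCurve hc hm hpos hlam hα (hK 0 ⟨le_rfl, hℓ.le⟩) (by
      rw [mul_div_cancel₀ _ hs.ne', h.left])
  have h1 : -(u' ℓ / √lam) = vOne f lam α C :=
    eq_vOne_of_mem_phaseCurve hc hm hpos hlam hα (u := u ℓ)
      (by
        obtain ⟨h1, h2⟩ := hK ℓ ⟨hℓ.le, le_rfl⟩
        refine ⟨?_, ?_⟩ <;> simp only [neg_sq] <;> assumption)
      (by rw [mul_neg, mul_div_cancel₀ _ hs.ne', h.right, neg_neg])
  have hcont : ContinuousOn (fun x => travelTime f C (u' x / √lam)) (Icc 0 ℓ) :=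
    (travelTime_continuous hc hm hpos C).comp_continuousOn (h.continuousOn.div_const _)
  -- The travel time of `u' / √lam` has constant derivative `-√lam`, so its total change `-2 T` over
  -- the interval equals `-√lam * ℓ`.
  obtain ⟨x, hx, hslope⟩ := exists_hasDerivAt_eq_slope
    (fun x => travelTime f C (u' x / √lam)) (fun _ => -√lam) hℓ hcont fun x hx => by
      refine (((travelTime_hasStrictDerivAt hc hm hpos C (u' x / √lam)).hasDerivAt).comp x
        ((h.equation x hx).div_const √lam)).congr_deriv ?_
      obtain ⟨h1, h2⟩ := hK x (Ioo_subset_Icc_self hx)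
      simp only at h1 h2
      rw [posInv_of_nonneg (sub_nonneg.2 h1), ← h2]
      have := (hpos (u x)).ne'
      nth_rewrite 1 [← Real.mul_self_sqrt hlam.le]
      field_simp
  simp only [h0, neg_eq_iff_eq_neg.1 h1, travelTime_neg] at hslope
  rw [length_eq_travelTime hc hm hpos hlam hα hC.le]
  rw [sub_zero, eq_div_iff hℓ.ne'] at hslope
  field_simp
  linarith

end Solutions

/-! ### Bounds and limits of the length. -/

section Bounds

variable {f : ℝ → ℝ} {lam α : ℝ}

/-- Up to `v₁` the ordinate is at least `γ v₁`, its value at the end. -/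
theorem travelTime_vOne_le (hc : Continuous f) (hm : Monotone f) (hpos : ∀ u, 0 < f u)
    (hlam : 0 < lam) (hα : 0 < α) {C : ℝ} (hC : 0 ≤ C) :
    travelTime f C (vOne f lam α C) ≤ vOne f lam α C / f (√lam / α * vOne f lam α C) := by
  obtain ⟨h0, -⟩ := vOne_spec hc hm hpos hlam hα hC
  have h : Continuous fun s : ℝ => 1 / f (posInv f (C - s ^ 2 / 2)) :=
    (continuous_inv_comp_posInv hc hm hpos).comp (by fun_prop)
  have := intervalIntegral.integral_mono_on (μ := MeasureTheory.volume) h0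
    (g := fun _ => 1 / f (√lam / α * vOne f lam α C)) (h.intervalIntegrable 0 _) (by simp)
    fun s hs => one_div_le_one_div_of_le (hpos _) (hm (by
      rw [← posInv_vOne hc hm hpos hlam hα hC]
      refine posInv_monotone hc hm hpos ?_
      have := pow_le_pow_left₀ hs.1 hs.2 2
      linarith))
  rw [intervalIntegral.integral_const, smul_eq_mul, sub_zero, mul_one_div] at this
  exact this

theorem travelTime_vOne_nonneg (hc : Continuous f) (hm : Monotone f) (hpos : ∀ u, 0 < f u)
    (hlam : 0 < lam) (hα : 0 < α) {C : ℝ} (hC : 0 ≤ C) :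
    0 ≤ travelTime f C (vOne f lam α C) :=
  (div_nonneg (vOne_spec hc hm hpos hlam hα hC).1 (hpos _).le).trans
    (div_le_travelTime hc hm hpos C (vOne_spec hc hm hpos hlam hα hC).1)

theorem length_nonneg (hc : Continuous f) (hm : Monotone f) (hpos : ∀ u, 0 < f u)
    (hlam : 0 < lam) (hα : 0 < α) {C : ℝ} (hC : 0 ≤ C) : 0 ≤ length f lam α C := by
  rw [length_eq_travelTime hc hm hpos hlam hα hC]
  have := travelTime_vOne_nonneg hc hm hpos hlam hα hC
  positivity

theorem length_pos (hc : Continuous f) (hm : Monotone f) (hpos : ∀ u, 0 < f u)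
    (hlam : 0 < lam) (hα : 0 < α) {C : ℝ} (hC : 0 < C) : 0 < length f lam α C := by
  rw [length_eq_travelTime hc hm hpos hlam hα hC.le]
  have hv := vOne_pos hc hm hpos hlam hα hC
  have := travelTime_strictMono hc hm hpos C hv
  rw [travelTime_zero] at this
  have hs : 0 < √lam := Real.sqrt_pos.2 hlam
  positivity

theorem length_le (hc : Continuous f) (hm : Monotone f) (hpos : ∀ u, 0 < f u)
    (hlam : 0 < lam) (hα : 0 < α) {C : ℝ} (hC : 0 ≤ C) :
    length f lam α C ≤ 2 / √lam * (vOne f lam α C / f (√lam / α * vOne f lam α C)) := by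
  rw [length_eq_travelTime hc hm hpos hlam hα hC]
  exact mul_le_mul_of_nonneg_left (travelTime_vOne_le hc hm hpos hlam hα hC) (by positivity)

theorem tendsto_div_comp_mul_atTop (hsuper : Tendsto (fun u => f u / u) atTop atTop) {γ : ℝ}
    (hγ : 0 < γ) : Tendsto (fun v => v / f (γ * v)) atTop (𝓝 0) := by
  have h1 : Tendsto (fun v : ℝ => γ * v) atTop atTop := tendsto_id.const_mul_atTop hγ
  have h2 := ((tendsto_inv_atTop_zero.comp hsuper).comp h1).const_mul γ⁻¹
  rw [mul_zero] at h2
  refine h2.congr fun v => ?_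
  simp only [Function.comp_apply, inv_div]
  field_simp

theorem exists_div_comp_mul_le (hm : Monotone f) (hpos : ∀ u, 0 < f u)
    (hsuper : Tendsto (fun u => f u / u) atTop atTop) {γ : ℝ} (hγ : 0 < γ) :
    ∃ M, ∀ v, 0 ≤ v → v / f (γ * v) ≤ M := by
  have h := (tendsto_div_comp_mul_atTop hsuper hγ).eventually (eventually_le_nhds zero_lt_one)
  obtain ⟨N, hN⟩ := eventually_atTop.1 h
  refine ⟨max 1 (N / f 0), fun v hv => ?_⟩
  rcases le_total N v with h | h
  · exact (hN v h).trans (le_max_left _ _)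
  · refine le_trans ?_ (le_max_right _ _)
    exact div_le_div₀ (hv.trans h) h (hpos 0) (hm (mul_nonneg hγ.le hv))

theorem exists_abs_length_le (hc : Continuous f) (hm : Monotone f) (hpos : ∀ u, 0 < f u)
    (hsuper : Tendsto (fun u => f u / u) atTop atTop) (hlam : 0 < lam) (hα : 0 < α) :
    ∃ M, ∀ C, 0 ≤ C → |length f lam α C| ≤ M := by
  have hγ : 0 < √lam / α := div_pos (Real.sqrt_pos.2 hlam) hα
  obtain ⟨M, hM⟩ := exists_div_comp_mul_le hm hpos hsuper hγ
  refine ⟨2 / √lam * M, fun C hC => ?_⟩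
  rw [abs_of_nonneg (length_nonneg hc hm hpos hlam hα hC)]
  exact (length_le hc hm hpos hlam hα hC).trans (mul_le_mul_of_nonneg_left
    (hM _ (vOne_spec hc hm hpos hlam hα hC).1) (by positivity))

theorem length_zero (hc : Continuous f) (hm : Monotone f) (hpos : ∀ u, 0 < f u)
    (hlam : 0 < lam) (hα : 0 < α) : length f lam α 0 = 0 := by
  have h := vOne_energy hc hm hpos hlam hα le_rfl
  simp only [energy, mul_zero, primitive_zero] at h
  norm_num at h
  rw [length_eq_travelTime hc hm hpos hlam hα le_rfl, h, travelTime_zero, mul_zero]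

theorem tendsto_length_zero (hc : Continuous f) (hm : Monotone f) (hpos : ∀ u, 0 < f u)
    (hlam : 0 < lam) (hα : 0 < α) : Tendsto (length f lam α) (𝓝[>] 0) (𝓝 0) := by
  have hγ : 0 < √lam / α := div_pos (Real.sqrt_pos.2 hlam) hα
  have h : Tendsto (fun C : ℝ => 2 / √lam * (√(2 * C) / f 0)) (𝓝[>] 0) (𝓝 0) := by
    have : Continuous fun C : ℝ => 2 / √lam * (√(2 * C) / f 0) := by fun_prop
    simpa using (this.tendsto 0).mono_left nhdsWithin_le_nhds
  refine squeeze_zero' ?_ ?_ h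
  · filter_upwards [self_mem_nhdsWithin] with C hC
    exact length_nonneg hc hm hpos hlam hα (le_of_lt hC)
  · filter_upwards [self_mem_nhdsWithin] with C hC
    have hC' : 0 ≤ C := le_of_lt hC
    have h0 := (vOne_spec hc hm hpos hlam hα hC').1
    refine (length_le hc hm hpos hlam hα hC').trans
      (mul_le_mul_of_nonneg_left (div_le_div₀ (Real.sqrt_nonneg _) ?_ (hpos 0)
        (hm (mul_nonneg hγ.le h0))) (by positivity))
    refine Real.le_sqrt_of_sq_le ?_
    linarith [vOne_sq_le hc hm hpos hlam hα hC']

theorem tendsto_vOne_atTop (hc : Continuous f) (hm : Monotone f) (hpos : ∀ u, 0 < f u)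
    (hlam : 0 < lam) (hα : 0 < α) : Tendsto (vOne f lam α) atTop atTop := by
  have hγ : 0 < √lam / α := div_pos (Real.sqrt_pos.2 hlam) hα
  refine tendsto_atTop.2 fun N => ?_
  filter_upwards [eventually_ge_atTop (energy f (√lam / α) (max N 0)), eventually_ge_atTop 0]
    with C hC hC0
  obtain ⟨h0, h1⟩ := vOne_spec hc hm hpos hlam hα hC0
  rw [← h1, (energy_strictMonoOn hc hpos hγ).le_iff_le (mem_Ici.2 (le_max_right N 0)) h0] at hC
  exact (le_max_left _ _).trans hC

theorem tendsto_length_atTop (hc : Continuous f) (hm : Monotone f) (hpos : ∀ u, 0 < f u)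
    (hsuper : Tendsto (fun u => f u / u) atTop atTop) (hlam : 0 < lam) (hα : 0 < α) :
    Tendsto (length f lam α) atTop (𝓝 0) := by
  have hγ : 0 < √lam / α := div_pos (Real.sqrt_pos.2 hlam) hα
  have h := ((tendsto_div_comp_mul_atTop hsuper hγ).comp
    (tendsto_vOne_atTop hc hm hpos hlam hα)).const_mul (2 / √lam)
  rw [mul_zero] at h
  refine squeeze_zero' ?_ ?_ h
  · filter_upwards [eventually_ge_atTop 0] with C hC
    exact length_nonneg hc hm hpos hlam hα hC
  · filter_upwards [eventually_ge_atTop 0] with C hC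
    exact length_le hc hm hpos hlam hα hC

end Bounds

/-! ### Differentiability of the length. -/

section Derivative

variable {f : ℝ → ℝ} {lam α : ℝ}

/-- Minus the derivative of `s ↦ 1 / f (F⁻¹(s))`. -/
def density (f : ℝ → ℝ) (s : ℝ) : ℝ := deriv f (posInv f s) / f (posInv f s) ^ 3

theorem density_continuous (hc : Continuous f) (hc' : Continuous (deriv f)) (hm : Monotone f)
    (hpos : ∀ u, 0 < f u) : Continuous (density f) :=
  (hc'.comp (posInv_continuous hc hm hpos)).div
    ((hc.comp (posInv_continuous hc hm hpos)).pow 3) fun _ => (pow_pos (hpos _) 3).ne'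

theorem inv_comp_posInv_hasDerivAt (hf : Differentiable ℝ f) (hm : Monotone f)
    (hpos : ∀ u, 0 < f u) {s : ℝ} (hs : 0 < s) :
    HasDerivAt (fun s => 1 / f (posInv f s)) (-density f s) s := by
  have h := ((hf (posInv f s)).hasDerivAt.comp s (posInv_hasDerivAt hf.continuous hm hpos hs)).inv
    (hpos _).ne'
  simp only [one_div]
  refine h.congr_deriv ?_
  have := (hpos (posInv f s)).ne'
  simp only [density, Function.comp_apply]
  field_simp

/-- Minus the derivative of the travel time with respect to the energy. -/
def delay (f : ℝ → ℝ) (C v : ℝ) : ℝ := ∫ s in (0 : ℝ)..v, density f (C - s ^ 2 / 2)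

/-- The energy at the point of abscissa `t w` of the trajectory through `(w, γ w)`, less its
kinetic part. -/
def rayPotential (f : ℝ → ℝ) (γ w t : ℝ) : ℝ := primitive f (γ * w) + w ^ 2 * (1 - t ^ 2) / 2

theorem rayPotential_pos (hc : Continuous f) (hpos : ∀ u, 0 < f u) {γ w t : ℝ} (hγ : 0 < γ)
    (hw : 0 < w) (ht : t ∈ Icc (0 : ℝ) 1) : 0 < rayPotential f γ w t := by
  have h1 := primitive_strictMono hc hpos (mul_pos hγ hw)
  rw [primitive_zero] at h1
  have h2 : 0 ≤ 1 - t ^ 2 := by nlinarith [ht.1, ht.2]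
  have := mul_nonneg (sq_nonneg w) h2
  simp only [rayPotential]
  linarith

/-- The substitution `s = w t` fixes the limits of integration, so that one can differentiate in `w`
under the integral sign. -/
theorem integral_energy_sub_eq (φ : ℝ → ℝ) (γ w : ℝ) :
    ∫ s in (0 : ℝ)..w, φ (energy f γ w - s ^ 2 / 2) =
      w * ∫ t in (0 : ℝ)..1, φ (rayPotential f γ w t) := by
  have h := intervalIntegral.mul_integral_comp_mul_left (a := 0) (b := 1) (c := w)
    (f := fun s => φ (energy f γ w - s ^ 2 / 2))
  rw [mul_zero, mul_one] at h
  rw [← h]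
  congr 1
  refine intervalIntegral.integral_congr fun t _ => ?_
  simp only [energy, rayPotential]
  congr 1
  ring

/-- The energy is parametrized by `w = v₁`. The result is the chain rule for `travelTime f C v`: the
first term comes from the moving limit, the second from the moving energy. -/
theorem travelTime_energy_hasDerivAt (hf : Differentiable ℝ f) (hc' : Continuous (deriv f))
    (hm : Monotone f) (hpos : ∀ u, 0 < f u) {γ w : ℝ} (hγ : 0 < γ) (hw : 0 < w) :
    HasDerivAt (fun w => travelTime f (energy f γ w) w)
      (1 / f (γ * w) - (γ * f (γ * w) + w) * delay f (energy f γ w) w) w := by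
  have hc := hf.continuous
  have hh := continuous_inv_comp_posInv hc hm hpos
  have hd := density_continuous hc hc' hm hpos
  have hF := primitive_continuous hc
  have hR : Continuous fun p : ℝ × ℝ => rayPotential f γ p.1 p.2 := by
    unfold rayPotential
    fun_prop
  have hRt : ∀ w, Continuous (rayPotential f γ w) := fun w =>
    hR.comp (Continuous.prodMk continuous_const continuous_id)
  have hRw : ∀ w t, HasDerivAt (fun w => rayPotential f γ w t)
      (γ * f (γ * w) + w * (1 - t ^ 2)) w := fun w t => by
    have h1 : HasDerivAt (fun w : ℝ => γ * w) γ w := by simpa using (hasDerivAt_id w).const_mul γ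
    have h2 := (primitive_hasStrictDerivAt hc (γ * w)).hasDerivAt.comp w h1
    have h3 := (((hasDerivAt_id w).pow 2).mul_const (1 - t ^ 2)).div_const 2
    refine (h2.add h3).congr_deriv ?_
    simp only [id]
    push_cast
    ring
  set G' : ℝ → ℝ → ℝ := fun w t => 1 / f (posInv f (rayPotential f γ w t)) +
    w * (-density f (rayPotential f γ w t) * (γ * f (γ * w) + w * (1 - t ^ 2))) with hG'
  have hG'c : Continuous fun p : ℝ × ℝ => G' p.1 p.2 := by
    have h1 := hh.comp hR
    have h2 := hd.comp hR
    simp only [Function.comp_def] at h1 h2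
    simp only [hG']
    fun_prop
  -- `G'` is jointly continuous, so on this compact set around `w` a constant dominates it.
  obtain ⟨B, hB⟩ := (isCompact_Icc (a := w / 2) (b := 2 * w)).prod
    (isCompact_Icc (a := (0 : ℝ)) (b := 1)) |>.exists_bound_of_continuousOn hG'c.continuousOn
  have hnhds : Icc (w / 2) (2 * w) ∈ 𝓝 w := Icc_mem_nhds (by linarith) (by linarith)
  have hGc : ∀ w, Continuous fun t => w * (1 / f (posInv f (rayPotential f γ w t))) := fun w =>
    continuous_const.mul (hh.comp (hRt w))
  have hG'w : ∀ w, Continuous (G' w) := fun w =>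
    hG'c.comp (Continuous.prodMk continuous_const continuous_id)
  have key := (intervalIntegral.hasDerivAt_integral_of_dominated_loc_of_deriv_le
    (μ := MeasureTheory.volume) (a := 0) (b := 1) (bound := fun _ => B)
    (F := fun w t => w * (1 / f (posInv f (rayPotential f γ w t)))) (F' := G') hnhds
    (Eventually.of_forall fun w => (hGc w).aestronglyMeasurable) ((hGc w).intervalIntegrable 0 1)
    (hG'w w).aestronglyMeasurable
    (Eventually.of_forall fun t ht y hy => hB (y, t) ⟨hy, by
      rw [uIoc_of_le zero_le_one] at ht
      exact Ioc_subset_Icc_self ht⟩) (by simp)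
    (Eventually.of_forall fun t ht y hy => by
      rw [uIoc_of_le zero_le_one] at ht
      have hS := rayPotential_pos hc hpos hγ (lt_of_lt_of_le (half_pos hw) hy.1)
        (Ioc_subset_Icc_self ht)
      refine ((hasDerivAt_id y).mul
        ((inv_comp_posInv_hasDerivAt hf hm hpos hS).comp y (hRw y t))).congr_deriv ?_
      simp [hG'])).2
  -- Integration by parts: the integrand is the derivative of `t / f(F⁻¹(rayPotential))`. It absorbs
  -- the part of `G'` that is not a multiple of the density by a constant in `t`.
  have hparts : ∫ t in (0 : ℝ)..1, (1 / f (posInv f (rayPotential f γ w t)) +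
      w ^ 2 * t ^ 2 * density f (rayPotential f γ w t)) = 1 / f (γ * w) := by
    have hd1 : ∀ t ∈ uIcc (0 : ℝ) 1, HasDerivAt
        (fun t => t * (1 / f (posInv f (rayPotential f γ w t))))
        (1 / f (posInv f (rayPotential f γ w t)) +
          w ^ 2 * t ^ 2 * density f (rayPotential f γ w t)) t := by
      intro t ht
      rw [uIcc_of_le zero_le_one] at ht
      have h1 : HasDerivAt (rayPotential f γ w) (-(w ^ 2 * t)) t := by
        refine ((((((hasDerivAt_id t).pow 2).const_sub 1).const_mul (w ^ 2)).div_const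
          2).const_add (primitive f (γ * w))).congr_deriv ?_
        simp only [id]
        push_cast
        ring
      refine ((hasDerivAt_id t).mul ((inv_comp_posInv_hasDerivAt hf hm hpos
        (rayPotential_pos hc hpos hγ hw ht)).comp t h1)).congr_deriv ?_
      simp only [id, Function.comp_apply]
      ring
    have hci : Continuous fun t => 1 / f (posInv f (rayPotential f γ w t)) +
        w ^ 2 * t ^ 2 * density f (rayPotential f γ w t) :=
      (hh.comp (hRt w)).add ((by fun_prop : Continuous fun t : ℝ => w ^ 2 * t ^ 2).mul
        (hd.comp (hRt w)))
    rw [intervalIntegral.integral_eq_sub_of_hasDerivAt hd1 (hci.intervalIntegrable 0 1)]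
    have h2 : posInv f (rayPotential f γ w 1) = γ * w := by
      have hnn := (mul_pos hγ hw).le
      have : rayPotential f γ w 1 = primitive f (γ * w) := by simp [rayPotential]
      rw [this, posInv_of_nonneg (primitive_nonneg hc hpos hnn),
        primitiveInv_primitive hc hm hpos hnn]
    rw [h2]
    ring
  have hint : ∫ t in (0 : ℝ)..1, G' w t =
      1 / f (γ * w) - (γ * f (γ * w) + w) * delay f (energy f γ w) w := by
    rw [delay, integral_energy_sub_eq, ← hparts, ← mul_assoc,
      ← intervalIntegral.integral_const_mul, ← intervalIntegral.integral_sub]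
    · refine intervalIntegral.integral_congr fun t _ => ?_
      simp only [hG']
      ring
    · exact Continuous.intervalIntegrable ((hh.comp (hRt w)).add
        ((by fun_prop : Continuous fun t : ℝ => w ^ 2 * t ^ 2).mul (hd.comp (hRt w)))) 0 1
    · exact Continuous.intervalIntegrable (continuous_const.mul (hd.comp (hRt w))) 0 1
  rw [hint] at key
  refine key.congr_of_eventuallyEq (Eventually.of_forall fun y => ?_)
  simp only [travelTime]
  rw [integral_energy_sub_eq (fun s => 1 / f (posInv f s)), intervalIntegral.integral_const_mul]

theorem length_hasDerivAt (hf : Differentiable ℝ f) (hc' : Continuous (deriv f))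
    (hm : Monotone f) (hpos : ∀ u, 0 < f u) (hlam : 0 < lam) (hα : 0 < α) {C v : ℝ} (hC : 0 < C)
    (hv : v = vOne f lam α C) :
    HasDerivAt (length f lam α) (2 / √lam * ((1 / f (√lam / α * v) -
      (√lam / α * f (√lam / α * v) + v) * delay f C v) *
        (√lam / α * f (√lam / α * v) + v)⁻¹)) C := by
  have hc := hf.continuous
  have hγ : 0 < √lam / α := div_pos (Real.sqrt_pos.2 hlam) hα
  have hE : energy f (√lam / α) v = C := hv ▸ (vOne_spec hc hm hpos hlam hα hC.le).2
  have hv0 : 0 < v := hv ▸ vOne_pos hc hm hpos hlam hα hC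
  have h1 := travelTime_energy_hasDerivAt hf hc' hm hpos hγ hv0
  have h2 := vOne_hasDerivAt hc hm hpos hlam hα hv0
  rw [hE] at h1 h2
  rw [hv] at h1
  have h3 := (h1.comp C h2).const_mul (2 / √lam)
  rw [← hv] at h3
  refine h3.congr_of_eventuallyEq ?_
  filter_upwards [lt_mem_nhds hC] with y hy
  rw [length_eq_travelTime hc hm hpos hlam hα hy.le, Function.comp_apply,
    (vOne_spec hc hm hpos hlam hα hy.le).2]

theorem delay_eq_of_deriv_length_eq_zero (hf : Differentiable ℝ f) (hc' : Continuous (deriv f))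
    (hm : Monotone f) (hpos : ∀ u, 0 < f u) (hlam : 0 < lam) (hα : 0 < α) {C v : ℝ} (hC : 0 < C)
    (hv : v = vOne f lam α C) (h : deriv (length f lam α) C = 0) :
    (√lam / α * f (√lam / α * v) + v) * delay f C v = 1 / f (√lam / α * v) := by
  have hs : 0 < √lam := Real.sqrt_pos.2 hlam
  have hv0 : 0 < v := hv ▸ vOne_pos hf.continuous hm hpos hlam hα hC
  have hp : 0 < √lam / α * f (√lam / α * v) + v :=
    add_pos (mul_pos (div_pos hs hα) (hpos _)) hv0
  rw [(length_hasDerivAt hf hc' hm hpos hlam hα hC hv).deriv] at h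
  have h1 := (mul_eq_zero.1 ((mul_eq_zero.1 h).resolve_left (by positivity))).resolve_right
    (inv_pos.2 hp).ne'
  linarith

end Derivative

/-! ### The critical point. -/

section Uniqueness

variable {f : ℝ → ℝ} {lam α : ℝ}

theorem tangent_lt (hf : Differentiable ℝ f) (hs : StrictMono (deriv f)) {a b : ℝ} (hab : a ≠ b) :
    f a + deriv f a * (b - a) < f b := by
  rcases lt_or_gt_of_ne hab with h | h
  · obtain ⟨c, hc, hc'⟩ := exists_deriv_eq_slope f h hf.continuous.continuousOn
      hf.differentiableOn
    rw [eq_div_iff (sub_pos.2 h).ne'] at hc'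
    nlinarith [hs hc.1]
  · obtain ⟨c, hc, hc'⟩ := exists_deriv_eq_slope f h hf.continuous.continuousOn
      hf.differentiableOn
    rw [eq_div_iff (sub_pos.2 h).ne'] at hc'
    nlinarith [hs hc.2]

theorem delay_hasDerivAt (hc : Continuous f) (hc' : Continuous (deriv f)) (hm : Monotone f)
    (hpos : ∀ u, 0 < f u) (C v : ℝ) :
    HasDerivAt (delay f C) (density f (C - v ^ 2 / 2)) v := by
  have h : Continuous fun s : ℝ => density f (C - s ^ 2 / 2) :=
    (density_continuous hc hc' hm hpos).comp (by fun_prop)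
  exact (h.integral_hasStrictDerivAt 0 v).hasDerivAt

theorem delay_nonneg (hm : Monotone f) (hpos : ∀ u, 0 < f u) (C : ℝ) {v : ℝ} (hv : 0 ≤ v) :
    0 ≤ delay f C v :=
  intervalIntegral.integral_nonneg hv fun _ _ =>
    div_nonneg hm.deriv_nonneg (pow_pos (hpos _) 3).le

/-- The solution of the linearized equation along the trajectory of energy `C`, namely the
derivative of the position with respect to the energy. -/
def variation (f : ℝ → ℝ) (C t : ℝ) : ℝ :=
  1 / f (position f C t) - velocity f C t * delay f C (velocity f C t)

/-- Minus the time derivative of `variation`. -/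
def variationRate (f : ℝ → ℝ) (C t : ℝ) : ℝ :=
  f (position f C t) * delay f C (velocity f C t)

theorem delay_velocity_hasDerivAt (hc : Continuous f) (hc' : Continuous (deriv f))
    (hm : Monotone f) (hpos : ∀ u, 0 < f u) (C t : ℝ) :
    HasDerivAt (fun t => delay f C (velocity f C t))
      (deriv f (position f C t) / f (position f C t) ^ 2) t := by
  refine ((delay_hasDerivAt hc hc' hm hpos C _).comp t
    (velocity_hasDerivAt hc hm hpos C t)).congr_deriv ?_
  change deriv f (position f C t) / f (position f C t) ^ 3 * f (position f C t) = _
  have := (hpos (position f C t)).ne'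
  field_simp

theorem variation_hasDerivAt (hf : Differentiable ℝ f) (hc' : Continuous (deriv f))
    (hm : Monotone f) (hpos : ∀ u, 0 < f u) {C t : ℝ} (h : velocity f C t ^ 2 / 2 < C) :
    HasDerivAt (variation f C) (-variationRate f C t) t := by
  have hc := hf.continuous
  have h1 := ((hf _).hasDerivAt.comp t (position_hasDerivAt hc hm hpos h)).inv (hpos _).ne'
  have h2 : HasDerivAt (velocity f C) (f (position f C t)) t := velocity_hasDerivAt hc hm hpos C t
  have h3 := h1.sub (h2.mul (delay_velocity_hasDerivAt hc hc' hm hpos C t))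
  refine (h3.congr_of_eventuallyEq (Eventually.of_forall fun y => ?_)).congr_deriv ?_
  · simp [variation]
  · have := (hpos (position f C t)).ne'
    simp only [variationRate, Function.comp_apply]
    field_simp
    ring

theorem variationRate_hasDerivAt (hf : Differentiable ℝ f) (hc' : Continuous (deriv f))
    (hm : Monotone f) (hpos : ∀ u, 0 < f u) {C t : ℝ} (h : velocity f C t ^ 2 / 2 < C) :
    HasDerivAt (variationRate f C) (deriv f (position f C t) * variation f C t) t := by
  have hc := hf.continuous
  have h1 := (hf _).hasDerivAt.comp t (position_hasDerivAt hc hm hpos h)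
  refine (h1.mul (delay_velocity_hasDerivAt hc hc' hm hpos C t)).congr_deriv ?_
  have := (hpos (position f C t)).ne'
  simp only [variation, Function.comp_apply]
  field_simp
  ring

/-- The Wronskian of the difference of the trajectories of energies `C` and `C₀` and of the
solution of the linearized equation along the latter. -/
def wronskian (f : ℝ → ℝ) (C₀ C t : ℝ) : ℝ :=
  (velocity f C₀ t - velocity f C t) * variation f C₀ t +
    (position f C t - position f C₀ t) * variationRate f C₀ t

/-- `variation` solves the linearized equation, so all that survives is the gap between `f` and its
tangent at `position f C₀ t`. -/
theorem wronskian_hasDerivAt (hf : Differentiable ℝ f) (hc' : Continuous (deriv f))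
    (hm : Monotone f) (hpos : ∀ u, 0 < f u) {C₀ C t : ℝ} (h₀ : velocity f C₀ t ^ 2 / 2 < C₀)
    (h : velocity f C t ^ 2 / 2 < C) :
    HasDerivAt (wronskian f C₀ C) (-(variation f C₀ t * (f (position f C t) -
      (f (position f C₀ t) +
        deriv f (position f C₀ t) * (position f C t - position f C₀ t))))) t := by
  have hc := hf.continuous
  have h1 : HasDerivAt (velocity f C) (f (position f C t)) t := velocity_hasDerivAt hc hm hpos C t
  have h2 : HasDerivAt (velocity f C₀) (f (position f C₀ t)) t :=
    velocity_hasDerivAt hc hm hpos C₀ t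
  refine (((h2.sub h1).mul (variation_hasDerivAt hf hc' hm hpos h₀)).add
    (((position_hasDerivAt hc hm hpos h).sub (position_hasDerivAt hc hm hpos h₀)).mul
      (variationRate_hasDerivAt hf hc' hm hpos h₀))).congr_deriv ?_
  simp only [Pi.sub_apply]
  ring

/-- A Sturm-type comparison of an arbitrary trajectory with the critical one, on the time interval
of the latter. -/
theorem travelTime_lt_of_deriv_length_eq_zero (hf : Differentiable ℝ f)
    (hc' : Continuous (deriv f)) (hm : Monotone f) (hs : StrictMono (deriv f))
    (hpos : ∀ u, 0 < f u) (hlam : 0 < lam) (hα : 0 < α) {C₀ C : ℝ} (hC₀ : 0 < C₀) (hC : 0 < C)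
    (hne : C ≠ C₀) (hcrit : deriv (length f lam α) C₀ = 0) :
    travelTime f C (vOne f lam α C) < travelTime f C₀ (vOne f lam α C₀) := by
  have hc := hf.continuous
  have hγ : 0 < √lam / α := div_pos (Real.sqrt_pos.2 hlam) hα
  by_contra! hle
  set γ := √lam / α with hγd
  set v := vOne f lam α C₀ with hv
  set T := travelTime f C₀ v with hT
  have hv0 : 0 < v := vOne_pos hc hm hpos hlam hα hC₀
  have hT0 : 0 < T := by
    simpa [travelTime_zero] using travelTime_strictMono hc hm hpos C₀ hv0
  have hV₀ : ∀ t ∈ Icc 0 T, velocity f C₀ t ^ 2 / 2 < C₀ := fun t ht =>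
    velocity_sq_lt hc hm hpos hlam hα hC₀ (by rw [abs_of_nonneg ht.1]; exact ht.2)
  have hV : ∀ t ∈ Icc 0 T, velocity f C t ^ 2 / 2 < C := fun t ht =>
    velocity_sq_lt hc hm hpos hlam hα hC (by rw [abs_of_nonneg ht.1]; exact ht.2.trans hle)
  have hVT : velocity f C₀ T = v := velocity_travelTime hc hm hpos C₀ v
  have hPT : position f C₀ T = γ * v := by
    rw [position, hVT]
    exact posInv_vOne hc hm hpos hlam hα hC₀.le
  have hp : 0 < γ * f (γ * v) + v := add_pos (mul_pos hγ (hpos _)) hv0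
  -- The only use of criticality. It yields `variation = γ * variationRate` at time `T`, the
  -- linearized Robin condition.
  have hdelay : delay f C₀ v = 1 / (f (γ * v) * (γ * f (γ * v) + v)) := by
    have := delay_eq_of_deriv_length_eq_zero hf hc' hm hpos hlam hα hC₀ hv hcrit
    have hfne := (hpos (γ * v)).ne'
    rw [← hγd] at this
    field_simp at this ⊢
    linarith
  have hwT : variation f C₀ T = γ / (γ * f (γ * v) + v) := by
    have hfne := (hpos (γ * v)).ne'
    rw [variation, hPT, hVT, hdelay]
    field_simp
    ring
  have hrT : variationRate f C₀ T = 1 / (γ * f (γ * v) + v) := by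
    have hfne := (hpos (γ * v)).ne'
    rw [variationRate, hPT, hVT, hdelay]
    field_simp
  have hanti : AntitoneOn (variation f C₀) (Icc 0 T) := by
    refine antitoneOn_of_deriv_nonpos (convex_Icc 0 T) (fun t ht =>
      (variation_hasDerivAt hf hc' hm hpos (hV₀ t ht)).continuousAt.continuousWithinAt) ?_ ?_
    · intro t ht
      exact (variation_hasDerivAt hf hc' hm hpos
        (hV₀ t (interior_subset ht))).differentiableAt.differentiableWithinAt
    · intro t ht
      have ht' := interior_subset ht
      rw [(variation_hasDerivAt hf hc' hm hpos (hV₀ t ht')).deriv, neg_nonpos]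
      refine mul_nonneg (hpos _).le (delay_nonneg hm hpos C₀ ?_)
      rw [← velocity_zero hc hm hpos C₀]
      exact velocity_monotone hc hm hpos C₀ ht'.1
  -- The variation decreases to the positive value `γ / (γ f(γ v) + v)`, so it is positive
  -- throughout.
  have hwpos : ∀ t ∈ Icc 0 T, 0 < variation f C₀ t := fun t ht =>
    lt_of_lt_of_le (hwT ▸ div_pos hγ hp) (hanti ht (right_mem_Icc.2 hT0.le) ht.2)
  have hW := fun t (ht : t ∈ Icc 0 T) => wronskian_hasDerivAt hf hc' hm hpos (hV₀ t ht) (hV t ht)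
  have hWanti : AntitoneOn (wronskian f C₀ C) (Icc 0 T) := by
    refine antitoneOn_of_deriv_nonpos (convex_Icc 0 T) (fun t ht =>
      (hW t ht).continuousAt.continuousWithinAt) (fun t ht =>
        (hW t (interior_subset ht)).differentiableAt.differentiableWithinAt) fun t ht => ?_
    rw [(hW t (interior_subset ht)).deriv, neg_nonpos]
    refine mul_nonneg (hwpos t (interior_subset ht)).le (sub_nonneg.2 ?_)
    rcases eq_or_ne (position f C₀ t) (position f C t) with h | h
    · simp [h]
    · exact (tangent_lt hf hs h).le
  have hW0 : wronskian f C₀ C 0 = 0 := by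
    simp [wronskian, variationRate, delay, velocity_zero hc hm hpos]
  -- By `hle` the trajectory of energy `C` has not yet crossed the line `u = γ v` at time `T`, and
  -- the linearized Robin condition reduces the Wronskian to a positive multiple of `u - γ v`.
  have hWT : 0 ≤ wronskian f C₀ C T := by
    have hle1 : velocity f C T ≤ vOne f lam α C := by
      have := velocity_monotone hc hm hpos C hle
      rwa [velocity_travelTime hc hm hpos] at this
    have h0 : 0 ≤ velocity f C T := by
      rw [← velocity_zero hc hm hpos C]
      exact velocity_monotone hc hm hpos C hT0.le
    have h1 : γ * velocity f C T ≤ position f C T := by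
      refine (mul_le_mul_of_nonneg_left hle1 hγ.le).trans ?_
      rw [hγd, ← posInv_vOne hc hm hpos hlam hα hC.le, position]
      refine posInv_monotone hc hm hpos ?_
      have := pow_le_pow_left₀ h0 hle1 2
      linarith
    have h2 : wronskian f C₀ C T =
        (position f C T - γ * velocity f C T) / (γ * f (γ * v) + v) := by
      rw [wronskian, hwT, hrT, hVT, hPT]
      ring
    rw [h2]
    exact div_nonneg (sub_nonneg.2 h1) hp.le
  have hWeq : EqOn (wronskian f C₀ C) (fun _ => 0) (Icc 0 T) := fun t ht =>
    le_antisymm (hW0 ▸ hWanti (left_mem_Icc.2 hT0.le) ht ht.1)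
      (hWT.trans (hWanti ht (right_mem_Icc.2 hT0.le) ht.2))
  have h0mem : (0 : ℝ) ∈ Icc 0 T := left_mem_Icc.2 hT0.le
  -- The Wronskian vanishes on `[0, T]`, so its derivative at `0` is `0`; but the apexes differ
  -- since `C ≠ C₀`, and strict convexity makes that derivative negative.
  have hd0 := (uniqueDiffOn_Icc hT0 0 h0mem).eq_deriv _ (hW 0 h0mem).hasDerivWithinAt
    ((hasDerivWithinAt_const (0 : ℝ) (Icc 0 T) (0 : ℝ)).congr hWeq hW0)
  have hpne : position f C₀ 0 ≠ position f C 0 := by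
    intro h
    have := congrArg (primitive f) h
    simp only [position, velocity_zero hc hm hpos, primitive_posInv hc hm hpos] at this
    norm_num at this
    rw [max_eq_left hC₀.le, max_eq_left hC.le] at this
    exact hne this.symm
  have := mul_pos (hwpos 0 h0mem) (sub_pos.2 (tangent_lt hf hs hpne))
  linarith

/-- `L(1) > 0`, while `L` tends to `0` at both ends: on a segment `[a, b]` around `1` with `L(a),
L(b) < L(1)` the maximum is interior. -/
theorem exists_deriv_length_eq_zero (hf : Differentiable ℝ f) (hc' : Continuous (deriv f))
    (hm : Monotone f) (hpos : ∀ u, 0 < f u) (hsuper : Tendsto (fun u => f u / u) atTop atTop)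
    (hlam : 0 < lam) (hα : 0 < α) : ∃ C, 0 < C ∧ deriv (length f lam α) C = 0 := by
  have hc := hf.continuous
  have h1 := length_pos hc hm hpos hlam hα one_pos
  obtain ⟨a, ha, ha0, ha1⟩ := ((tendsto_length_zero hc hm hpos hlam hα).eventually
    (gt_mem_nhds h1) |>.and (Ioo_mem_nhdsGT one_pos)).exists
  obtain ⟨b, hb, hb1⟩ := ((tendsto_length_atTop hc hm hpos hsuper hlam hα).eventually
    (gt_mem_nhds h1) |>.and (eventually_gt_atTop 1)).exists
  have hcont : ContinuousOn (length f lam α) (Icc a b) := fun C hC =>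
    (length_hasDerivAt hf hc' hm hpos hlam hα (ha0.trans_le hC.1)
      rfl).continuousAt.continuousWithinAt
  obtain ⟨C, hC, hmax⟩ := isCompact_Icc.exists_isMaxOn ⟨1, ha1.le, hb1.le⟩ hcont
  have hle : length f lam α 1 ≤ length f lam α C := hmax ⟨ha1.le, hb1.le⟩
  have haC : a ≠ C := fun h => by rw [h] at ha; linarith
  have hbC : C ≠ b := fun h => by rw [← h] at hb; linarith
  exact ⟨C, ha0.trans_le hC.1, (hmax.isLocalMax (Icc_mem_nhds (lt_of_le_of_ne hC.1 haC)
    (lt_of_le_of_ne hC.2 hbC))).deriv_eq_zero⟩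

end Uniqueness

end RobinTimeMap

end

theorem mainTheorem1 (f : ℝ → ℝ) (hf : Differentiable ℝ f) (hf' : Differentiable ℝ (deriv f))
    (hpos : ∀ u, 0 < f u) (hmono : ∀ u, 0 ≤ deriv f u)
    (hsuper : Tendsto (fun u => f u / u) atTop atTop)
    (hconv : ∀ u, 0 < deriv (deriv f) u)
    (lam α : ℝ) (hlam : 0 < lam) (hα : 0 < α) :
    -- `L(C)` is the length of the interval of the Robin solutions whose trajectory lies on `K_C`
    (∀ C, 0 < C → ∀ ℓ, 0 < ℓ →
      ((∃ u u' : ℝ → ℝ, RobinTimeMap.IsRobinSolution f lam α ℓ u u' ∧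
          ∀ x ∈ Icc 0 ℓ, (u' x / Real.sqrt lam, u x) ∈ RobinTimeMap.phaseCurve f C) ↔
        ℓ = RobinTimeMap.length f lam α C)) ∧
    (∃ M : ℝ, ∀ C, 0 ≤ C → |RobinTimeMap.length f lam α C| ≤ M) ∧
    RobinTimeMap.length f lam α 0 = 0 ∧
    Tendsto (RobinTimeMap.length f lam α) (𝓝[>] 0) (𝓝 0) ∧
    Tendsto (RobinTimeMap.length f lam α) atTop (𝓝 0) ∧
    DifferentiableOn ℝ (RobinTimeMap.length f lam α) (Ioi 0) ∧
    ∃! C : ℝ, 0 < C ∧ deriv (RobinTimeMap.length f lam α) C = 0 := by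
  have hc := hf.continuous
  have hc' := hf'.continuous
  have hm : Monotone f := monotone_of_deriv_nonneg hf hmono
  have hs : StrictMono (deriv f) := strictMono_of_deriv_pos hconv
  refine ⟨fun C hC ℓ hℓ => ⟨?_, ?_⟩, RobinTimeMap.exists_abs_length_le hc hm hpos hsuper hlam hα,
    RobinTimeMap.length_zero hc hm hpos hlam hα,
    RobinTimeMap.tendsto_length_zero hc hm hpos hlam hα,
    RobinTimeMap.tendsto_length_atTop hc hm hpos hsuper hlam hα, fun C hC =>
      (RobinTimeMap.length_hasDerivAt hf hc' hm hpos hlam hα hC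
        rfl).differentiableAt.differentiableWithinAt, ?_⟩
  · rintro ⟨u, u', hu, hK⟩
    exact hu.eq_length hc hm hpos hlam hα hC hℓ hK
  · rintro rfl
    exact RobinTimeMap.exists_robinSolution hc hm hpos hlam hα hC
  · obtain ⟨C₀, hC₀, hcrit₀⟩ :=
      RobinTimeMap.exists_deriv_length_eq_zero hf hc' hm hpos hsuper hlam hα
    refine ⟨C₀, ⟨hC₀, hcrit₀⟩, fun C ⟨hC, hcrit⟩ => ?_⟩
    by_contra hne
    -- Each of two distinct critical points would have a travel time strictly larger than the other.
    exact lt_asymm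
      (RobinTimeMap.travelTime_lt_of_deriv_length_eq_zero hf hc' hm hs hpos hlam hα hC₀ hC hne
        hcrit₀)
      (RobinTimeMap.travelTime_lt_of_deriv_length_eq_zero hf hc' hm hs hpos hlam hα hC hC₀
        (Ne.symm hne) hcrit)
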